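/- Let $\mathbb T=\mathbb R/2\pi\mathbb Z$, and let $|x-y|$ denote the distance on $\mathbb T$ (modulo $2\pi$); diameters and distances of sets refer to it. Let $H:\mathbb R\to[0,1]$ be a low pass filter, i.e. $H$ is infinitely differentiable and even, $H(t)=1$ for $|t|\le 1/2$ and $H(t)=0$ for $|t|\ge 1$. For integers $n\ge1$ and $S\ge 2$ put $$\hbar_n=\Big\{\sum_{|\ell|<n}H(|\ell|/n)\Big\}^{-1},\qquad L=\frac{14\sqrt{2\pi}}{3}\cdot\frac{\|H^{(S)}\|_1}{\|H\|_1},$$ where $\|f\|_1=\int_{-1}^1|f(t)|\,dt$. Let $K\ge 1$, $\lambda_1,\dots,\lambda_K\in\mathbb T$, $A_1,\dots,A_K\in\mathbb C\setminus\{0\}$, and $$M=\sum_{k=1}^K|A_k|,\quad \mathfrak m=\min_{1\le k\le K}|A_k|,\quad \eta=\min_{k\ne \ell}|\lambda_k-\lambda_\ell|\ \ (\eta=\infty\text{ if }K=1),\quad C=\max\Big(1,\Big(\frac{16ML}{\mathfrak m}\Big)^{1/S}\Big).$$ Let the data be $\tilde\mu(\ell)=\sum_{k=1}^K A_k e^{-i\ell\lambda_k}+\epsilon_\ell$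 for $|\ell|<n$, where the $\epsilon_\ell$ are i.i.d. complex random variables whose real and imaginary parts are sub-Gaussian with parameter $V\ge0$: each of these real variables $X$ has mean zero and satisfies $\log\mathbb E(\exp(tX))\le (tV)^2/2$ for all $t\in\mathbb R$. Let $$\sigma_n(x)=\hbar_n\sum_{|\ell|<n}H\Big(\frac{|\ell|}{n}\Big)\tilde\mu(\ell)e^{i\ell x},\qquad \mathbb G=\{x\in\mathbb T:\ |\sigma_n(x)|\ge \mathfrak m/2\}.$$ There are constants $C_1\ge1$ and $C_2,C_3>0$, depending only on $H$, such that, whenever $0<\delta<1$ and $$n\ge \max(4C/\eta,\,C_1),\qquad C_2V\sqrt{\frac{\log(C_3n/\delta)}{n}}\le\frac{\mathfrak m}{16},$$ the following statements hold simultaneously with probability exceeding $1-\delta$: 1. (Disjoint union) $\mathbb G$ is a disjoint union of exactly $K$ (nonempty) subsets $\mathbb G_1,\dots,\mathbb G_K$, such that: 2. (Diameter) $\operatorname{diam}(\mathbb G_\ell)\le 2C/n$ for each $\ell$; 3. (Separation) $\operatorname{dist}(\mathbb G_\ell,\mathbb G_k)\ge\eta/2$ for $\ell\ne k$; 4. (Interval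 inclusion) $\{x\in\mathbb T:|x-\lambda_\ell|\le 1/(4n)\}\subseteq\mathbb G_\ell$ for each $\ell$; 5. (Estimation) for each $\ell$, $|\sigma_n|$ attains its maximum on $\mathbb G_\ell$, and every $\hat\lambda_\ell\in\arg\max_{x\in\mathbb G_\ell}|\sigma_n(x)|$ satisfies $|\hat\lambda_\ell-\lambda_\ell|\le 2C/n$. -/

import Mathlib

open MeasureTheory ProbabilityTheory
open scoped ENNReal NNReal

noncomputable section

/-- The circle `ℝ / 2πℤ`, with its quotient metric (the distance modulo `2π`). The character
`x ↦ exp (i ℓ x)` on it is Mathlib's `fourier ℓ`. -/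
abbrev Torus : Type := AddCircle (2 * Real.pi)

/-- A low pass filter: a smooth even function `ℝ → [0,1]`, equal to `1` for `|t| ≤ 1/2` and to `0`
for `|t| ≥ 1`. -/
structure IsLowPassFilter (H : ℝ → ℝ) : Prop where
  smooth : ContDiff ℝ ((⊤ : ℕ∞) : WithTop ℕ∞) H
  mem_Icc : ∀ t, H t ∈ Set.Icc (0 : ℝ) 1
  even : ∀ t, H (-t) = H t
  eq_one : ∀ t, |t| ≤ 1 / 2 → H t = 1
  eq_zero : ∀ t, 1 ≤ |t| → H t = 0

/-- The `L¹` norm on `[-1, 1]`. -/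
def l1Norm (f : ℝ → ℝ) : ℝ := ∫ t in (-1 : ℝ)..1, |f t|

/-- The constant `L = (14 √(2π) / 3) ‖H^(S)‖₁ / ‖H‖₁`. -/
def locConst (H : ℝ → ℝ) (S : ℕ) : ℝ :=
  14 * √(2 * Real.pi) / 3 * (l1Norm (iteratedDeriv S H) / l1Norm H)

/-- The normalizing factor `ħ_n = (∑_{|ℓ| < n} H(|ℓ|/n))⁻¹`. -/
def hbar (H : ℝ → ℝ) (n : ℕ) : ℝ :=
  (∑ ℓ ∈ Finset.Ioo (-(n : ℤ)) (n : ℤ), H (|(ℓ : ℝ)| / n))⁻¹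

/-- The reconstruction `σ_n(x) = ħ_n ∑_{|ℓ| < n} H(|ℓ|/n) d(ℓ) exp(i ℓ x)` from data `d`. -/
def powerSpectrum (H : ℝ → ℝ) (n : ℕ) (d : ℤ → ℂ) (x : Torus) : ℂ :=
  (hbar H n : ℂ) *
    ∑ ℓ ∈ Finset.Ioo (-(n : ℤ)) (n : ℤ), (H (|(ℓ : ℝ)| / n) : ℂ) * d ℓ * fourier ℓ x

/-- The Fourier coefficient `∑_k A_k exp(-i ℓ λ_k)` of the measure `∑_k A_k δ_{λ_k}`. -/
def fourierData {K : ℕ} (A : Fin K → ℂ) (lam : Fin K → Torus) (ℓ : ℤ) : ℂ :=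
  ∑ k, A k * fourier (-ℓ) (lam k)

/-- `M = ∑_k |A_k|`. -/
def totalAmplitude {K : ℕ} (A : Fin K → ℂ) : ℝ := ∑ k, ‖A k‖

/-- `𝔪 = min_k |A_k|` (used for `K ≥ 1`). -/
def minAmplitude {K : ℕ} (A : Fin K → ℂ) : ℝ := ⨅ k, ‖A k‖

/-- `η = min_{k ≠ l} |λ_k - λ_l|`, the distance being that of the circle. It is extended-real
valued so that it is `∞`, the minimum over no pairs, when there is a single point. -/
def minSeparation {K : ℕ} (lam : Fin K → Torus) : ℝ≥0∞ :=
  ⨅ (k : Fin K) (l : Fin K) (_ : k ≠ l), edist (lam k) (lam l)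

/-- `C = max (1, (16 M L / 𝔪)^(1/S))`. -/
def clusterConst (H : ℝ → ℝ) (S : ℕ) {K : ℕ} (A : Fin K → ℂ) : ℝ :=
  max 1 ((16 * totalAmplitude A * locConst H S / minAmplitude A) ^ (1 / (S : ℝ)))

/-- A complex random variable is sub-Gaussian with parameter `V` if its real and imaginary parts
are: `𝔼 exp(tX) ≤ exp((tV)²/2)` for all real `t` (in particular they have mean zero). -/
def IsComplexSubGaussian {Ω : Type*} [MeasurableSpace Ω] (X : Ω → ℂ) (V : ℝ≥0)
    (P : Measure Ω) : Prop :=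
  HasSubgaussianMGF (fun ω => (X ω).re) (V ^ 2) P ∧
    HasSubgaussianMGF (fun ω => (X ω).im) (V ^ 2) P

/-- The set `{x : |σ(x)| ≥ 𝔪/2}`. -/
def levelSet (σ : Torus → ℂ) (m : ℝ) : Set Torus := {x | m / 2 ≤ ‖σ x‖}

end

/-!
Writing `Φ_n` for the reconstruction of a unit point mass at `0`, linearity gives
`σ_n(x) = ∑_k A_k Φ_n(x - λ_k) + noise`. By Poisson summation and `S` integrations by parts
`|Φ_n(x)| ≤ L / (n|x|)^S`, whereas `|Φ_n(x)| ≥ 31/32` for `|x| ≤ 1/(4n)`, since there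
`cos(ℓx) ≥ 31/32` for all `|ℓ| < n`. The constant `C` is such that at a point at distance at least
`C/n` from a set of the `λ_k`, these contribute at most `𝔪/16` altogether. At a fixed point the
noise is sub-Gaussian with variance proxy `O(V²/n)`, and a union bound over a grid of `O(n²)`
points, whose values control a trigonometric polynomial of degree less than `n` up to a factor `2`,
makes it at most `𝔪/16` everywhere. Hence `|σ_n| ≥ 𝔪/2` holds within `1/(4n)` of every `λ_k` and
fails at distance more than `C/n` from all of them, and the balls of radius `C/n` about the `λ_k`
are `η/2` apart because `η ≥ 4C/n`.
-/

section PoissonSummation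

open scoped FourierTransform SchwartzMap ContDiff Real

variable {E : Type*} [NormedAddCommGroup E]

section NormedSpace

variable [NormedSpace ℝ E]

theorem hasCompactSupport_iteratedDeriv {f : ℝ → E} (hf : HasCompactSupport f) (S : ℕ) :
    HasCompactSupport (iteratedDeriv S f) := by
  induction S with
  | zero => rwa [iteratedDeriv_zero]
  | succ S ih => rw [iteratedDeriv_succ]; exact ih.deriv

theorem integral_norm_iteratedDeriv_comp_div {f : ℝ → E} {S : ℕ} (hf : ContDiff ℝ S f) {a : ℝ}
    (ha : 0 < a) :
    ∫ t, ‖iteratedDeriv S (fun s => f (s / a)) t‖ = a / a ^ S * ∫ t, ‖iteratedDeriv S f t‖ := by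
  have hderiv (t : ℝ) : ‖iteratedDeriv S (fun s => f (s / a)) t‖
      = (a ^ S)⁻¹ * ‖iteratedDeriv S f (t / a)‖ := by
    have := congrFun (iteratedDeriv_comp_const_smul hf a⁻¹) t
    simp only [div_eq_inv_mul] at this ⊢
    rw [this, norm_smul, norm_pow, norm_inv, Real.norm_of_nonneg ha.le, inv_pow]
  simp_rw [hderiv]
  rw [integral_const_mul, Measure.integral_comp_div (fun t => ‖iteratedDeriv S f t‖), abs_of_pos ha,
    smul_eq_mul]
  ring

end NormedSpace

theorem pow_mul_norm_fourierInv_le [NormedSpace ℂ E] {f : ℝ → E} {S : ℕ} (hf : ContDiff ℝ S f)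
    (hint : ∀ m ≤ S, Integrable (iteratedDeriv m f)) (w : ℝ) :
    (2 * π * |w|) ^ S * ‖𝓕⁻ f w‖ ≤ ∫ t, ‖iteratedDeriv S f t‖ := by
  have hderiv := congrFun (Real.fourier_iteratedDeriv (N := S) hf
    (fun m hm => hint m (by exact_mod_cast hm)) le_rfl) (-w)
  have hnorm : (2 * π * |w|) ^ S * ‖𝓕⁻ f w‖ = ‖𝓕 (iteratedDeriv S f) (-w)‖ := by
    rw [hderiv, Real.fourierInv_eq_fourier_neg, norm_smul, norm_pow]
    simp [abs_of_pos Real.pi_pos]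
  exact hnorm.trans_le (VectorFourier.norm_fourierIntegral_le_integral_norm _ _ _ _ _)

theorem sum_mul_fourier_eq_tsum_fourierInv {f : ℝ → ℂ} (hf : ContDiff ℝ ∞ f)
    (hc : HasCompactSupport f) {s : Finset ℤ} (hs : ∀ ℓ : ℤ, ℓ ∉ s → f ℓ = 0) (y : ℝ) :
    ∑ ℓ ∈ s, f ℓ * fourier ℓ (y : UnitAddCircle) = ∑' j : ℤ, 𝓕⁻ f (y + j) := by
  have hpoisson := SchwartzMap.tsum_eq_tsum_fourier (𝓕⁻ (hc.toSchwartzMap hf)) y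
  rw [FourierTransform.fourier_fourierInv_eq, SchwartzMap.fourierInv_coe] at hpoisson
  have hcoe : (hc.toSchwartzMap hf : ℝ → ℂ) = f := rfl
  rw [hcoe] at hpoisson
  rw [hpoisson, tsum_eq_sum fun ℓ hℓ => by rw [hs ℓ hℓ, zero_mul]]

theorem hasSum_int_indicator_add_one_div_sq :
    HasSum (fun j : ℤ => (if j = 0 then 1 else 0) + 1 / (j : ℝ) ^ 2) (1 + π ^ 2 / 3) := by
  refine (hasSum_ite_eq (0 : ℤ) (1 : ℝ)).add ?_
  convert! HasSum.of_nat_of_neg (f := fun j : ℤ => 1 / (j : ℝ) ^ 2)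
    (by simpa using hasSum_zeta_two) (by simpa using hasSum_zeta_two) using 1
  rw [Int.cast_zero]
  ring

theorem abs_mul_abs_le_abs_add_int {y : ℝ} (hy : |y| ≤ 1 / 2) (j : ℤ) :
    |(j : ℝ)| * |y| ≤ |y + j| := by
  obtain rfl | hj := eq_or_ne j 0
  · simp
  have hj1 : (1 : ℝ) ≤ |(j : ℝ)| := by exact_mod_cast Int.one_le_abs hj
  have htri : |(j : ℝ)| - |y| ≤ |y + j| := by
    simpa [add_comm] using abs_sub_abs_le_abs_sub (j : ℝ) (-y)
  nlinarith

theorem inv_abs_add_int_pow_le {y : ℝ} (hy : y ≠ 0) (hy2 : |y| ≤ 1 / 2) {S : ℕ} (hS : 2 ≤ S)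
    (j : ℤ) :
    (|y + j| ^ S)⁻¹ ≤ (|y| ^ S)⁻¹ * ((if j = 0 then 1 else 0) + 1 / (j : ℝ) ^ 2) := by
  obtain rfl | hj := eq_or_ne j 0
  · simp
  have hj1 : (1 : ℝ) ≤ |(j : ℝ)| := by exact_mod_cast Int.one_le_abs hj
  have hpow : |y| ^ S * (j : ℝ) ^ 2 ≤ |y + j| ^ S := calc
    |y| ^ S * (j : ℝ) ^ 2 ≤ |y| ^ S * |(j : ℝ)| ^ S := by rw [← sq_abs (j : ℝ)]; gcongr
    _ = (|(j : ℝ)| * |y|) ^ S := by ring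
    _ ≤ |y + j| ^ S := by gcongr; exact abs_mul_abs_le_abs_add_int hy2 j
  rw [if_neg hj, zero_add, one_div, ← mul_inv]
  exact inv_anti₀ (by positivity) hpow

theorem norm_tsum_add_int_le {g : ℝ → E} {S : ℕ} (hS : 2 ≤ S) {B : ℝ}
    (hg : ∀ w, |w| ^ S * ‖g w‖ ≤ B) {y : ℝ} (hy : y ≠ 0) (hy2 : |y| ≤ 1 / 2) :
    ‖∑' j : ℤ, g (y + j)‖ ≤ B / |y| ^ S * (1 + π ^ 2 / 3) := by
  refine tsum_of_norm_bounded (hasSum_int_indicator_add_one_div_sq.mul_left _) fun j => ?_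
  have hB : 0 ≤ B := (by positivity : 0 ≤ |y| ^ S * ‖g y‖).trans (hg y)
  have hyj : y + j ≠ 0 := by
    intro h0
    have hle := abs_mul_abs_le_abs_add_int hy2 j
    rw [h0, abs_zero] at hle
    have hj : j ≠ 0 := by rintro rfl; simp [hy] at h0
    exact hle.not_gt (by positivity)
  calc ‖g (y + j)‖ ≤ B * (|y + j| ^ S)⁻¹ := by
        rw [← div_eq_mul_inv, le_div_iff₀' (by positivity)]; exact hg _
    _ ≤ B * ((|y| ^ S)⁻¹ * _) := by gcongr; exact inv_abs_add_int_pow_le hy hy2 hS j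
    _ = B / |y| ^ S * _ := by ring

theorem exists_coe_eq_abs_eq_norm {T : ℝ} (hT : 0 < T) (x : AddCircle T) :
    ∃ r : ℝ, (r : AddCircle T) = x ∧ |r| = ‖x‖ := by
  have : Fact (0 < T) := ⟨hT⟩
  obtain ⟨r, hr, rfl⟩ := (AddCircle.coe_image_Icc_eq T (-(T / 2))).ge (Set.mem_univ x)
  refine ⟨r, rfl, ((AddCircle.norm_coe_eq_abs_iff T hT.ne').2 ?_).symm⟩
  rw [abs_of_pos hT, abs_le]
  exact ⟨hr.1, by linarith [hr.2]⟩

theorem norm_sum_mul_fourier_le {f : ℝ → ℂ} (hf : ContDiff ℝ ∞ f) (hc : HasCompactSupport f)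
    {s : Finset ℤ} (hs : ∀ ℓ : ℤ, ℓ ∉ s → f ℓ = 0) {S : ℕ} (hS : 2 ≤ S) {T : ℝ} (hT : 0 < T)
    {x : AddCircle T} (hx : x ≠ 0) :
    ‖∑ ℓ ∈ s, f ℓ * fourier ℓ x‖
      ≤ (∫ t, ‖iteratedDeriv S f t‖) / (2 * π / T * ‖x‖) ^ S * (1 + π ^ 2 / 3) := by
  obtain ⟨r, rfl, hr⟩ := exists_coe_eq_abs_eq_norm hT x
  have hr0 : r ≠ 0 := by rintro rfl; exact hx rfl
  have habs : |r / T| = |r| / T := by rw [abs_div, abs_of_pos hT]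
  have hhalf : |r / T| ≤ 1 / 2 := by
    rw [habs, div_le_iff₀ hT, hr]
    simpa [abs_of_pos hT, div_eq_inv_mul] using AddCircle.norm_le_half_period T hT.ne'
  have hrescale (ℓ : ℤ) :
      fourier ℓ (r : AddCircle T) = fourier ℓ ((r / T : ℝ) : UnitAddCircle) := by
    rw [fourier_coe_apply, fourier_coe_apply]
    congr 1
    push_cast
    ring
  have hdecay (w : ℝ) : |w| ^ S * ‖𝓕⁻ f w‖ ≤ (∫ t, ‖iteratedDeriv S f t‖) / (2 * π) ^ S := by
    rw [le_div_iff₀' (by positivity), ← mul_assoc, ← mul_pow]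
    exact pow_mul_norm_fourierInv_le (hf.of_le (by exact_mod_cast le_top)) (fun m _ =>
      (hf.continuous_iteratedDeriv m (by exact_mod_cast le_top)).integrable_of_hasCompactSupport
        (hasCompactSupport_iteratedDeriv hc m)) w
  simp_rw [hrescale]
  rw [sum_mul_fourier_eq_tsum_fourierInv hf hc hs]
  refine (norm_tsum_add_int_le hS hdecay (div_ne_zero hr0 hT.ne') hhalf).trans_eq ?_
  rw [habs, div_div, ← mul_pow, ← hr]
  ring_nf

end PoissonSummation

/-- The kernel `Φ_n(x) = ħ_n ∑_{|ℓ| < n} H(|ℓ|/n) exp(i ℓ x)`, encoded as the reconstruction of the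
point mass at `0`, all of whose Fourier coefficients are `1`. -/
noncomputable def lowPassKernel (H : ℝ → ℝ) (n : ℕ) : Torus → ℂ := powerSpectrum H n 1

theorem re_lowPassKernel_coe (H : ℝ → ℝ) (n : ℕ) (r : ℝ) :
    (lowPassKernel H n (r : Torus)).re =
      hbar H n * ∑ ℓ ∈ Finset.Ioo (-(n : ℤ)) n, H (|(ℓ : ℝ)| / n) * Real.cos (ℓ * r) := by
  simp only [lowPassKernel, powerSpectrum, Pi.one_apply, mul_one]
  rw [Complex.re_ofReal_mul, Complex.re_sum]
  congr 2 with ℓ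
  rw [Complex.re_ofReal_mul, fourier_coe_apply, ← Complex.exp_ofReal_mul_I_re]
  congr 3
  push_cast
  field_simp

theorem one_le_abs_div_of_notMem_Ioo {n : ℕ} (hn : 0 < n) {ℓ : ℤ}
    (hℓ : ℓ ∉ Finset.Ioo (-(n : ℤ)) n) : 1 ≤ |(ℓ : ℝ) / n| := by
  have hle : (n : ℤ) ≤ |ℓ| := not_lt.1 fun h => hℓ (Finset.mem_Ioo.2 (abs_lt.1 h))
  rw [abs_div, Nat.abs_cast, one_le_div (by positivity)]
  exact_mod_cast hle

namespace IsLowPassFilter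

open scoped ContDiff Real

variable {H : ℝ → ℝ} {n : ℕ}

theorem hasCompactSupport (hH : IsLowPassFilter H) : HasCompactSupport H :=
  .intro (isCompact_Icc (a := -1) (b := 1)) fun t ht =>
    hH.eq_zero t (not_lt.1 fun h => ht (abs_le.1 h.le))

theorem tsupport_subset (hH : IsLowPassFilter H) : tsupport H ⊆ Set.Icc (-1) 1 := by
  refine closure_minimal (fun t ht => ?_) isClosed_Icc
  by_contra h
  exact ht (hH.eq_zero t (not_lt.1 fun h' => h (abs_le.1 h'.le)))

theorem norm_iteratedDeriv_ofReal_comp (hH : IsLowPassFilter H) (S : ℕ) (t : ℝ) :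
    ‖iteratedDeriv S (fun s => (H s : ℂ)) t‖ = |iteratedDeriv S H t| := by
  rw [← Real.norm_eq_abs, ← norm_iteratedFDeriv_eq_norm_iteratedDeriv,
    ← norm_iteratedFDeriv_eq_norm_iteratedDeriv]
  exact Complex.ofRealLI.norm_iteratedFDeriv_comp_left hH.smooth.contDiffAt
    (by exact_mod_cast le_top)

theorem integral_norm_iteratedDeriv_ofReal_comp (hH : IsLowPassFilter H) (S : ℕ) :
    ∫ t, ‖iteratedDeriv S (fun s => (H s : ℂ)) t‖ = l1Norm (iteratedDeriv S H) := by
  simp_rw [hH.norm_iteratedDeriv_ofReal_comp]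
  rw [l1Norm, intervalIntegral.integral_of_le (by norm_num), ← integral_Icc_eq_integral_Ioc,
    setIntegral_eq_integral_of_forall_compl_eq_zero]
  intro t ht
  rw [← Real.norm_eq_abs, ← norm_iteratedFDeriv_eq_norm_iteratedDeriv, norm_eq_zero]
  by_contra h
  exact ht (hH.tsupport_subset (support_iteratedFDeriv_subset (𝕜 := ℝ) S h))

theorem l1Norm_iteratedDeriv_nonneg (hH : IsLowPassFilter H) (S : ℕ) :
    0 ≤ l1Norm (iteratedDeriv S H) := by
  rw [← hH.integral_norm_iteratedDeriv_ofReal_comp]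
  positivity

theorem l1Norm_pos (hH : IsLowPassFilter H) : 0 < l1Norm H := by
  refine intervalIntegral.integral_pos (by norm_num) hH.smooth.continuous.abs.continuousOn
    (fun _ _ => abs_nonneg _) ⟨0, by norm_num, ?_⟩
  rw [hH.eq_one 0 (by norm_num)]
  norm_num

theorem l1Norm_le_two (hH : IsLowPassFilter H) : l1Norm H ≤ 2 := calc
  l1Norm H ≤ ∫ _ in (-1 : ℝ)..1, (1 : ℝ) :=
    intervalIntegral.integral_mono_on (by norm_num)
      (hH.smooth.continuous.abs.intervalIntegrable _ _) intervalIntegrable_const fun t _ => by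
        rw [abs_of_nonneg (hH.mem_Icc t).1]
        exact (hH.mem_Icc t).2
  _ = 2 := by norm_num

theorem locConst_nonneg (hH : IsLowPassFilter H) (S : ℕ) : 0 ≤ locConst H S := by
  have := hH.l1Norm_iteratedDeriv_nonneg S
  have := hH.l1Norm_pos
  unfold locConst
  positivity

theorem l1Norm_iteratedDeriv_mul_le_locConst (hH : IsLowPassFilter H) (S : ℕ) :
    l1Norm (iteratedDeriv S H) * (1 + π ^ 2 / 3) ≤ locConst H S := by
  set D := l1Norm (iteratedDeriv S H)
  have hD : 0 ≤ D := hH.l1Norm_iteratedDeriv_nonneg S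
  have hpos := hH.l1Norm_pos
  have hquot : D ≤ 2 * (D / l1Norm H) := by
    rw [mul_div_assoc', le_div_iff₀ hpos]
    nlinarith [hH.l1Norm_le_two]
  have hpi : π ^ 2 ≤ 10 := by nlinarith [Real.pi_lt_d2, Real.pi_pos]
  have hsqrt : 5 / 2 ≤ √(2 * π) := Real.le_sqrt_of_sq_le (by linarith [Real.pi_gt_d2])
  calc D * (1 + π ^ 2 / 3) ≤ 2 * (D / l1Norm H) * (13 / 3) := by gcongr; linarith
    _ = 26 / 3 * (D / l1Norm H) := by ring
    _ ≤ 14 * √(2 * π) / 3 * (D / l1Norm H) := by gcongr; linarith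

theorem natCast_le_sum (hH : IsLowPassFilter H) (hn : 0 < n) :
    (n : ℝ) ≤ ∑ ℓ ∈ Finset.Ioo (-(n : ℤ)) n, H (|(ℓ : ℝ)| / n) := by
  set I := Finset.Icc (-((n / 2 : ℕ) : ℤ)) (n / 2 : ℕ)
  have hsub : I ⊆ Finset.Ioo (-(n : ℤ)) n := fun ℓ hℓ => by
    simp only [I, Finset.mem_Icc, Finset.mem_Ioo] at hℓ ⊢
    omega
  have hcard : n ≤ I.card := by rw [Int.card_Icc]; omega
  have hone : ∀ ℓ ∈ I, H (|(ℓ : ℝ)| / n) = 1 := fun ℓ hℓ => by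
    have hle : 2 * |ℓ| ≤ n := by
      have := abs_le.2 (Finset.mem_Icc.1 hℓ)
      omega
    have hle' : 2 * |(ℓ : ℝ)| ≤ n := by exact_mod_cast hle
    apply hH.eq_one
    rw [abs_of_nonneg (by positivity), div_le_iff₀ (by positivity)]
    linarith
  calc (n : ℝ) ≤ I.card := by exact_mod_cast hcard
    _ = ∑ ℓ ∈ I, H (|(ℓ : ℝ)| / n) := by rw [Finset.sum_congr rfl hone]; simp
    _ ≤ _ := Finset.sum_le_sum_of_subset_of_nonneg hsub fun _ _ _ => (hH.mem_Icc _).1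

theorem hbar_pos (hH : IsLowPassFilter H) (hn : 0 < n) : 0 < hbar H n :=
  inv_pos.2 ((Nat.cast_pos.2 hn).trans_le (hH.natCast_le_sum hn))

theorem hbar_le_inv (hH : IsLowPassFilter H) (hn : 0 < n) : hbar H n ≤ (n : ℝ)⁻¹ :=
  inv_anti₀ (by positivity) (hH.natCast_le_sum hn)

theorem hbar_mul_sum (hH : IsLowPassFilter H) (hn : 0 < n) :
    hbar H n * ∑ ℓ ∈ Finset.Ioo (-(n : ℤ)) n, H (|(ℓ : ℝ)| / n) = 1 :=
  inv_mul_cancel₀ (inv_pos.1 (hH.hbar_pos hn)).ne'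

theorem comp_abs_div (hH : IsLowPassFilter H) (t a : ℝ) : H (|t| / a) = H (t / a) := by
  rcases abs_choice t with h | h <;> rw [h]
  rw [neg_div, hH.even]

theorem norm_sum_mul_fourier_le (hH : IsLowPassFilter H) (hn : 0 < n) {S : ℕ} (hS : 2 ≤ S)
    {x : Torus} (hx : x ≠ 0) :
    ‖∑ ℓ ∈ Finset.Ioo (-(n : ℤ)) n, (H (|(ℓ : ℝ)| / n) : ℂ) * fourier ℓ x‖
      ≤ n * (locConst H S / (n * ‖x‖) ^ S) := by
  have hsmooth : ContDiff ℝ ∞ fun t => (H t : ℂ) := Complex.ofRealCLM.contDiff.comp hH.smooth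
  have hcompact : HasCompactSupport fun t : ℝ => (H (t / n) : ℂ) := by
    simp only [div_eq_mul_inv]
    exact (hH.hasCompactSupport.comp_left Complex.ofReal_zero).comp_homeomorph
      (.mulRight₀ (n : ℝ)⁻¹ (by positivity))
  have hzero (ℓ : ℤ) (hℓ : ℓ ∉ Finset.Ioo (-(n : ℤ)) n) : (H (ℓ / n) : ℂ) = 0 := by
    rw [hH.eq_zero _ (one_le_abs_div_of_notMem_Ioo hn hℓ), Complex.ofReal_zero]
  have hbound := _root_.norm_sum_mul_fourier_le (hsmooth.comp (contDiff_id.div_const (n : ℝ)))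
    hcompact hzero hS Real.two_pi_pos hx
  simp only [Function.comp_def, id] at hbound
  rw [div_self Real.two_pi_pos.ne', one_mul, integral_norm_iteratedDeriv_comp_div
    (hsmooth.of_le (by exact_mod_cast le_top)) (by positivity),
    hH.integral_norm_iteratedDeriv_ofReal_comp] at hbound
  simp_rw [hH.comp_abs_div]
  calc _ ≤ n / (n : ℝ) ^ S * l1Norm (iteratedDeriv S H) / ‖x‖ ^ S * (1 + π ^ 2 / 3) := hbound
    _ = n * (l1Norm (iteratedDeriv S H) * (1 + π ^ 2 / 3) / (n * ‖x‖) ^ S) := by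
        rw [mul_pow, div_mul_eq_div_div]
        ring
    _ ≤ n * (locConst H S / (n * ‖x‖) ^ S) := by
        gcongr
        exact hH.l1Norm_iteratedDeriv_mul_le_locConst S

theorem norm_lowPassKernel_le (hH : IsLowPassFilter H) (hn : 0 < n) {S : ℕ} (hS : 2 ≤ S)
    {x : Torus} (hx : x ≠ 0) : ‖lowPassKernel H n x‖ ≤ locConst H S / (n * ‖x‖) ^ S := by
  have := hH.locConst_nonneg S
  simp only [lowPassKernel, powerSpectrum, Pi.one_apply, mul_one]
  rw [norm_mul, Complex.norm_real, Real.norm_of_nonneg (hH.hbar_pos hn).le]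
  calc _ ≤ (n : ℝ)⁻¹ * (n * (locConst H S / (n * ‖x‖) ^ S)) :=
        mul_le_mul (hH.hbar_le_inv hn) (hH.norm_sum_mul_fourier_le hn hS hx) (norm_nonneg _)
          (by positivity)
    _ = locConst H S / (n * ‖x‖) ^ S := inv_mul_cancel_left₀ (by positivity) _

theorem le_norm_lowPassKernel (hH : IsLowPassFilter H) (hn : 0 < n) {x : Torus}
    (hx : ‖x‖ ≤ 1 / (4 * n)) : 31 / 32 ≤ ‖lowPassKernel H n x‖ := by
  obtain ⟨r, rfl, hr⟩ := exists_coe_eq_abs_eq_norm Real.two_pi_pos x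
  have hcos : ∀ ℓ ∈ Finset.Ioo (-(n : ℤ)) n, 31 / 32 ≤ Real.cos (ℓ * r) := fun ℓ hℓ => by
    have hℓn : |(ℓ : ℝ)| ≤ n := by exact_mod_cast (abs_lt.2 (Finset.mem_Ioo.1 hℓ)).le
    have hℓr : |ℓ * r| ≤ 1 / 4 := calc
      |ℓ * r| = |(ℓ : ℝ)| * |r| := abs_mul _ _
      _ ≤ n * (1 / (4 * n)) := by gcongr; exact hr.trans_le hx
      _ = 1 / 4 := by field_simp
    have := sq_le_sq' (abs_le.1 hℓr).1 (abs_le.1 hℓr).2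
    linarith [Real.one_sub_sq_div_two_le_cos (x := ℓ * r)]
  calc 31 / 32 = hbar H n * ∑ ℓ ∈ Finset.Ioo (-(n : ℤ)) n, H (|(ℓ : ℝ)| / n) * (31 / 32) := by
        rw [← Finset.sum_mul, ← mul_assoc, hH.hbar_mul_sum hn, one_mul]
    _ ≤ hbar H n * ∑ ℓ ∈ Finset.Ioo (-(n : ℤ)) n, H (|(ℓ : ℝ)| / n) * Real.cos (ℓ * r) :=
        mul_le_mul_of_nonneg_left (Finset.sum_le_sum fun ℓ hℓ =>
          mul_le_mul_of_nonneg_left (hcos ℓ hℓ) (hH.mem_Icc _).1) (hH.hbar_pos hn).le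
    _ = (lowPassKernel H n r).re := (re_lowPassKernel_coe H n r).symm
    _ ≤ ‖lowPassKernel H n r‖ := Complex.re_le_norm _

end IsLowPassFilter

section TrigonometricPolynomial

open scoped Real

variable {T : ℝ}

theorem norm_fourier_apply (ℓ : ℤ) (x : AddCircle T) : ‖fourier ℓ x‖ = 1 := by
  rw [fourier_apply, Circle.norm_coe]

theorem fourier_neg_mul_fourier (ℓ : ℤ) (x y : AddCircle T) :
    fourier (-ℓ) y * fourier ℓ x = fourier ℓ (x - y) := by
  simp only [fourier_apply, ← Circle.coe_mul, ← AddCircle.toCircle_add]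
  rw [neg_smul, smul_sub, neg_add_eq_sub]

theorem norm_fourier_sub_le (hT : 0 < T) (ℓ : ℤ) (x y : AddCircle T) :
    ‖fourier ℓ x - fourier ℓ y‖ ≤ 2 * π / T * |(ℓ : ℝ)| * dist x y := by
  have hshift : fourier (-ℓ) y * (fourier ℓ x - fourier ℓ y) = fourier ℓ (x - y) - 1 := by
    rw [mul_sub, fourier_neg_mul_fourier, fourier_neg_mul_fourier, sub_self, fourier_eval_zero]
  obtain ⟨r, hr, hr'⟩ := exists_coe_eq_abs_eq_norm hT (x - y)
  have hexp : fourier ℓ (r : AddCircle T) = Complex.exp (Complex.I * (2 * π / T * ℓ * r : ℝ)) := by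
    rw [fourier_coe_apply]
    congr 1
    push_cast
    ring
  calc ‖fourier ℓ x - fourier ℓ y‖ = ‖fourier ℓ (x - y) - 1‖ := by
        rw [← hshift, norm_mul, norm_fourier_apply, one_mul]
    _ ≤ ‖2 * π / T * ℓ * r‖ := by
        rw [← hr, hexp]
        exact Real.norm_exp_I_mul_ofReal_sub_one_le
    _ = 2 * π / T * |(ℓ : ℝ)| * dist x y := by
        rw [norm_mul, norm_mul, Real.norm_of_nonneg (by positivity), Real.norm_eq_abs,
          Real.norm_eq_abs, hr', dist_eq_norm]

theorem exists_finset_card_le_dist_le (hT : 0 < T) {N : ℕ} (hN : 0 < N) :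
    ∃ s : Finset (AddCircle T), s.card ≤ N ∧ ∀ x, ∃ y ∈ s, dist x y ≤ T / N := by
  classical
  have : Fact (0 < T) := ⟨hT⟩
  have hq : 0 < T / N := by positivity
  refine ⟨(Finset.range N).image fun j : ℕ => ((T / N * j : ℝ) : AddCircle T),
    Finset.card_image_le.trans (Finset.card_range N).le, fun x => ?_⟩
  obtain ⟨r, hr, rfl⟩ := (AddCircle.coe_image_Ico_eq T 0).ge (Set.mem_univ x)
  have hr0 : 0 ≤ r / (T / N) := div_nonneg hr.1 hq.le
  have hlt : ⌊r / (T / N)⌋₊ < N := by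
    rw [Nat.floor_lt hr0, div_lt_iff₀ hq, mul_div_cancel₀ T (by positivity)]
    linarith [hr.2]
  refine ⟨_, Finset.mem_image_of_mem _ (Finset.mem_range.2 hlt), ?_⟩
  have hfloor := Nat.floor_le hr0
  have hfloor' := Nat.lt_floor_add_one (r / (T / N))
  rw [le_div_iff₀ hq] at hfloor
  rw [div_lt_iff₀ hq] at hfloor'
  rw [dist_eq_norm, ← AddCircle.coe_sub]
  refine QuotientAddGroup.norm_mk_le_norm.trans ?_
  rw [Real.norm_eq_abs, abs_le]
  constructor <;> linarith

variable [Fact (0 < T)] {s : Finset ℤ} {c : ℤ → ℂ}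

theorem fourierCoeff_sum_mul_fourier (s : Finset ℤ) (c : ℤ → ℂ) {m : ℤ} (hm : m ∈ s) :
    fourierCoeff (fun x : AddCircle T => ∑ ℓ ∈ s, c ℓ * fourier ℓ x) m = c m := by
  have hcoeff (ℓ : ℤ) : fourierCoeff (fun x : AddCircle T => c ℓ * fourier ℓ x) m
      = if ℓ = m then c m else 0 := by
    rw [fourierCoeff.const_mul, fourierCoeff_fourier]
    obtain rfl | hℓ := eq_or_ne ℓ m
    · rw [Pi.single_eq_same, mul_one, if_pos rfl]
    · rw [Pi.single_eq_of_ne hℓ.symm, mul_zero, if_neg hℓ]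
  rw [← Finset.sum_fn, fourierCoeff.sum, Finset.sum_apply]
  · simp only [hcoeff, Finset.sum_ite_eq', if_pos hm]
  · intro ℓ _
    have hcont : Continuous fun x : AddCircle T => c ℓ * fourier ℓ x := by fun_prop
    exact hcont.integrable_of_hasCompactSupport (.of_compactSpace _)

theorem norm_coeff_le_of_norm_sum_le {B : ℝ}
    (hB : ∀ x : AddCircle T, ‖∑ ℓ ∈ s, c ℓ * fourier ℓ x‖ ≤ B) {m : ℤ} (hm : m ∈ s) :
    ‖c m‖ ≤ B := by
  rw [← fourierCoeff_sum_mul_fourier (T := T) s c hm, fourierCoeff]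
  refine (norm_integral_le_of_norm_le_const (C := B) (ae_of_all _ fun x => ?_)).trans (by simp)
  rw [norm_smul, norm_fourier_apply, one_mul]
  exact hB x

theorem norm_sum_mul_fourier_sub_le {n : ℕ} {B : ℝ}
    (hB : ∀ x : AddCircle T, ‖∑ ℓ ∈ Finset.Ioo (-(n : ℤ)) n, c ℓ * fourier ℓ x‖ ≤ B)
    (x y : AddCircle T) :
    ‖∑ ℓ ∈ Finset.Ioo (-(n : ℤ)) n, c ℓ * fourier ℓ x
        - ∑ ℓ ∈ Finset.Ioo (-(n : ℤ)) n, c ℓ * fourier ℓ y‖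
      ≤ 4 * π * n ^ 2 / T * B * dist x y := by
  have hT : 0 < T := Fact.out
  have hB0 : 0 ≤ B := (norm_nonneg _).trans (hB 0)
  have hcard : (Finset.Ioo (-(n : ℤ)) n).card ≤ 2 * n := by rw [Int.card_Ioo]; omega
  rw [← Finset.sum_sub_distrib]
  calc _ ≤ ∑ ℓ ∈ Finset.Ioo (-(n : ℤ)) n, B * (2 * π / T * n * dist x y) :=
        norm_sum_le_of_le _ fun ℓ hℓ => by
          have hℓn : |(ℓ : ℝ)| ≤ n := by exact_mod_cast (abs_lt.2 (Finset.mem_Ioo.1 hℓ)).le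
          rw [← mul_sub, norm_mul]
          gcongr
          · exact norm_coeff_le_of_norm_sum_le hB hℓ
          · exact (norm_fourier_sub_le hT ℓ x y).trans (by gcongr)
    _ = (Finset.Ioo (-(n : ℤ)) n).card * (B * (2 * π / T * n * dist x y)) := by
        rw [Finset.sum_const, nsmul_eq_mul]
    _ ≤ (2 * n) * (B * (2 * π / T * n * dist x y)) := by gcongr; exact_mod_cast hcard
    _ = 4 * π * n ^ 2 / T * B * dist x y := by ring

-- At a point where the polynomial has its maximum modulus `B`, moving to a nearest grid point
-- changes it by at most `4π/26 · B ≤ B/2`.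
theorem exists_norming_finset (T : ℝ) [Fact (0 < T)] {n : ℕ} (hn : 0 < n) :
    ∃ s : Finset (AddCircle T), s.card ≤ 26 * n ^ 2 ∧ ∀ (c : ℤ → ℂ) (t : ℝ),
      (∀ y ∈ s, ‖∑ ℓ ∈ Finset.Ioo (-(n : ℤ)) n, c ℓ * fourier ℓ y‖ ≤ t) →
        ∀ x : AddCircle T, ‖∑ ℓ ∈ Finset.Ioo (-(n : ℤ)) n, c ℓ * fourier ℓ x‖ ≤ 2 * t := by
  have hT : 0 < T := Fact.out
  obtain ⟨s, hcard, hs⟩ := exists_finset_card_le_dist_le hT (N := 26 * n ^ 2) (by positivity)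
  refine ⟨s, hcard, fun c t ht x => ?_⟩
  set p : AddCircle T → ℂ := fun x => ∑ ℓ ∈ Finset.Ioo (-(n : ℤ)) n, c ℓ * fourier ℓ x
  have hp : Continuous fun x => ‖p x‖ := by fun_prop
  obtain ⟨x₀, -, hx₀⟩ := isCompact_univ.exists_isMaxOn Set.univ_nonempty hp.continuousOn
  have hmax (x : AddCircle T) : ‖p x‖ ≤ ‖p x₀‖ := hx₀ (Set.mem_univ x)
  obtain ⟨y, hy, hdist⟩ := hs x₀
  have hdiff : ‖p x₀ - p y‖ ≤ ‖p x₀‖ / 2 := calc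
    ‖p x₀ - p y‖ ≤ 4 * π * n ^ 2 / T * ‖p x₀‖ * dist x₀ y := norm_sum_mul_fourier_sub_le hmax x₀ y
    _ ≤ 4 * π * n ^ 2 / T * ‖p x₀‖ * (T / (26 * n ^ 2 : ℕ)) := by gcongr
    _ = ‖p x₀‖ * (4 * π / 26) := by push_cast; field_simp
    _ ≤ ‖p x₀‖ * (1 / 2) :=
        mul_le_mul_of_nonneg_left (by linarith [Real.pi_lt_d2]) (norm_nonneg _)
    _ = ‖p x₀‖ / 2 := by ring
  linarith [hmax x, ht y hy, norm_le_norm_add_norm_sub' (p x₀) (p y)]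

end TrigonometricPolynomial

section SubGaussian

variable {Ω : Type*} [MeasurableSpace Ω] {P : Measure Ω}

theorem hasSubgaussianMGF_of_le {X : Ω → ℝ} {c c' : ℝ≥0} (h : HasSubgaussianMGF X c P)
    (hc : c ≤ c') : HasSubgaussianMGF X c' P where
  integrable_exp_mul := h.integrable_exp_mul
  mgf_le t := (h.mgf_le t).trans (by gcongr)

-- `HasSubgaussianMGF.measure_ge_le` says nothing for `c = 0`, where its exponent is `-s² / 0 = 0`.
theorem measureReal_ge_le_exp_neg [IsFiniteMeasure P] {X : Ω → ℝ} {c : ℝ≥0}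
    (h : HasSubgaussianMGF X c P) {s Λ : ℝ} (hs : 0 < s) (hΛ : 0 ≤ Λ) (hc : 2 * c * Λ ≤ s ^ 2) :
    P.real {ω | s ≤ X ω} ≤ Real.exp (-Λ) := by
  have hexponent : -(2 * Λ / s) * s + c * (2 * Λ / s) ^ 2 / 2 ≤ -Λ := calc
    _ = -(2 * Λ) + 2 * c * Λ * Λ / s ^ 2 := by field_simp
    _ ≤ -(2 * Λ) + s ^ 2 * Λ / s ^ 2 := by gcongr
    _ = -Λ := by rw [mul_div_cancel_left₀ _ (by positivity)]; ring
  calc P.real {ω | s ≤ X ω} ≤ Real.exp (-(2 * Λ / s) * s) * mgf X P (2 * Λ / s) :=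
        measure_ge_le_exp_mul_mgf s (by positivity) (h.integrable_exp_mul _)
    _ ≤ Real.exp (-(2 * Λ / s) * s) * Real.exp (c * (2 * Λ / s) ^ 2 / 2) := by
        gcongr
        exact h.mgf_le _
    _ ≤ Real.exp (-Λ) := by rw [← Real.exp_add]; gcongr

-- The real and imaginary parts need not be independent, which costs the factor `2`.
theorem IsComplexSubGaussian.hasSubgaussianMGF_re_mul {X : Ω → ℂ} {V : ℝ≥0}
    (h : IsComplexSubGaussian X V P) (z : ℂ) :
    HasSubgaussianMGF (fun ω => (z * X ω).re) (2 * V ^ 2 * ‖z‖₊ ^ 2) P := by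
  have hadd := (h.1.const_mul z.re).add (h.2.const_mul (-z.im))
  simp only [neg_mul, ← sub_eq_add_neg, ← Complex.mul_re] at hadd
  refine hasSubgaussianMGF_of_le hadd (add_sq_le.trans ?_)
  rw [NNReal.sq_sqrt, NNReal.sq_sqrt, ← NNReal.coe_le_coe]
  change 2 * (z.re ^ 2 * (V : ℝ) ^ 2 + (-z.im) ^ 2 * (V : ℝ) ^ 2) ≤ 2 * (V : ℝ) ^ 2 * ‖z‖ ^ 2
  rw [Complex.sq_norm, Complex.normSq_apply]
  linarith

theorem exists_le_re_I_pow_mul {w : ℂ} {r : ℝ} (hw : 2 * r ≤ ‖w‖) :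
    ∃ q ∈ Finset.range 4, r ≤ (Complex.I ^ q * w).re := by
  by_contra! hlt
  have h0 := hlt 0 (by simp)
  have h1 := hlt 1 (by simp)
  have h2 := hlt 2 (by simp)
  have h3 := hlt 3 (by simp)
  rw [Complex.I_sq] at h2
  rw [Complex.I_pow_three] at h3
  simp only [pow_zero, pow_one, one_mul, neg_mul, Complex.neg_re, Complex.I_mul_re, neg_neg]
    at h0 h1 h2 h3
  have hre : |w.re| < r := abs_lt.2 ⟨by linarith, h0⟩
  have him : |w.im| < r := abs_lt.2 ⟨by linarith, h3⟩
  linarith [Complex.norm_le_abs_re_add_abs_im w]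

variable {ι : Type*} {ε : ι → Ω → ℂ} {V : ℝ≥0} {s : Finset ι} {z : ι → ℂ} {r Λ : ℝ}

theorem measureReal_re_sum_mul_ge_le (hind : iIndepFun ε P)
    (hsub : ∀ i ∈ s, IsComplexSubGaussian (ε i) V P) (hr : 0 < r) (hΛ : 0 ≤ Λ)
    (hz : 4 * V ^ 2 * Λ * ∑ i ∈ s, ‖z i‖ ^ 2 ≤ r ^ 2) :
    P.real {ω | r ≤ (∑ i ∈ s, z i * ε i ω).re} ≤ Real.exp (-Λ) := by
  have := hind.isProbabilityMeasure
  have hsum := HasSubgaussianMGF.sum_of_iIndepFun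
    (hind.comp (fun i w => (z i * w).re) fun i => by fun_prop)
    fun i hi => (hsub i hi).hasSubgaussianMGF_re_mul (z i)
  simp_rw [Complex.re_sum]
  refine measureReal_ge_le_exp_neg hsum hr hΛ (hz.trans_eq' ?_)
  rw [← Finset.mul_sum]
  push_cast
  ring

theorem measureReal_norm_sum_mul_ge_le (hind : iIndepFun ε P)
    (hsub : ∀ i ∈ s, IsComplexSubGaussian (ε i) V P) (hr : 0 < r) (hΛ : 0 ≤ Λ)
    (hz : 4 * V ^ 2 * Λ * ∑ i ∈ s, ‖z i‖ ^ 2 ≤ r ^ 2) :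
    P.real {ω | 2 * r ≤ ‖∑ i ∈ s, z i * ε i ω‖} ≤ 4 * Real.exp (-Λ) := by
  have := hind.isProbabilityMeasure
  have hcover : {ω | 2 * r ≤ ‖∑ i ∈ s, z i * ε i ω‖}
      ⊆ ⋃ q ∈ Finset.range 4, {ω | r ≤ (∑ i ∈ s, Complex.I ^ q * z i * ε i ω).re} := fun ω hω => by
    obtain ⟨q, hq, hle⟩ := exists_le_re_I_pow_mul hω
    simp only [Finset.mul_sum, ← mul_assoc] at hle
    exact Set.mem_biUnion hq hle
  calc _ ≤ P.real (⋃ q ∈ Finset.range 4, _) := measureReal_mono hcover (measure_ne_top _ _)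
    _ ≤ ∑ q ∈ Finset.range 4, P.real _ := measureReal_biUnion_finset_le _ _
    _ ≤ ∑ _ ∈ Finset.range 4, Real.exp (-Λ) := Finset.sum_le_sum fun _ _ =>
        measureReal_re_sum_mul_ge_le hind hsub hr hΛ (by simpa using hz)
    _ = 4 * Real.exp (-Λ) := by rw [Finset.sum_const, Finset.card_range, nsmul_eq_mul]; norm_num

end SubGaussian

section Noise

theorem powerSpectrum_eq_sum (H : ℝ → ℝ) (n : ℕ) (d : ℤ → ℂ) (x : Torus) :
    powerSpectrum H n d x = ∑ ℓ ∈ Finset.Ioo (-(n : ℤ)) (n : ℤ),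
      (hbar H n * H (|(ℓ : ℝ)| / n) : ℝ) * d ℓ * fourier ℓ x := by
  rw [powerSpectrum, Finset.mul_sum]
  refine Finset.sum_congr rfl fun ℓ _ => ?_
  push_cast
  ring

theorem mul_sq_mul_exp_neg_log_lt {n : ℕ} (hn : 0 < n) {δ : ℝ} (hδ : 0 < δ) (hδ1 : δ < 1) :
    104 * (n : ℝ) ^ 2 * Real.exp (-(4 * Real.log (4 * n / δ))) < δ := by
  have hn1 : (1 : ℝ) ≤ n := by exact_mod_cast hn
  have hexp : Real.exp (-(4 * Real.log (4 * n / δ))) = (δ / (4 * n)) ^ 4 := by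
    rw [← inv_div (4 * (n : ℝ)), ← Real.exp_log (by positivity : 0 < 4 * n / δ), ← Real.exp_neg,
      ← Real.exp_nat_mul, Real.log_exp]
    norm_num
  have hle : δ ^ 3 / (n : ℝ) ^ 2 ≤ 1 :=
    div_le_one_of_le₀ ((pow_le_one₀ hδ.le hδ1.le).trans (one_le_pow₀ hn1)) (by positivity)
  calc _ = δ * (104 / 256 * (δ ^ 3 / n ^ 2)) := by rw [hexp]; field_simp; norm_num
    _ < δ := mul_lt_of_lt_one_right hδ (by linarith)

namespace IsLowPassFilter

variable {H : ℝ → ℝ} {n : ℕ}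

theorem sum_hbar_mul_sq_le (hH : IsLowPassFilter H) (hn : 0 < n) :
    ∑ ℓ ∈ Finset.Ioo (-(n : ℤ)) n, (hbar H n * H (|(ℓ : ℝ)| / n)) ^ 2 ≤ (n : ℝ)⁻¹ := by
  have hbar_nonneg := (hH.hbar_pos hn).le
  calc _ ≤ ∑ ℓ ∈ Finset.Ioo (-(n : ℤ)) n, hbar H n * (hbar H n * H (|(ℓ : ℝ)| / n)) :=
        Finset.sum_le_sum fun ℓ _ => by
          obtain ⟨hnonneg, hle⟩ := hH.mem_Icc (|(ℓ : ℝ)| / n)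
          rw [sq]
          exact mul_le_mul_of_nonneg_right (mul_le_of_le_one_right hbar_nonneg hle)
            (mul_nonneg hbar_nonneg hnonneg)
    _ = hbar H n := by rw [← Finset.mul_sum, ← Finset.mul_sum, hH.hbar_mul_sum hn, mul_one]
    _ ≤ (n : ℝ)⁻¹ := hH.hbar_le_inv hn

variable {Ω : Type*} [MeasurableSpace Ω] {P : Measure Ω} {V : ℝ≥0} {ε : ℤ → Ω → ℂ} {r Λ : ℝ}

theorem measureReal_norm_powerSpectrum_ge_le (hH : IsLowPassFilter H) (hn : 0 < n)
    (hind : iIndepFun (fun ℓ : {ℓ : ℤ // |ℓ| < n} => ε ℓ) P)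
    (hsub : ∀ ℓ : ℤ, |ℓ| < n → IsComplexSubGaussian (ε ℓ) V P) (hr : 0 < r) (hΛ : 0 ≤ Λ)
    (hV : 4 * V ^ 2 * Λ ≤ n * r ^ 2) (x : Torus) :
    P.real {ω | 2 * r ≤ ‖powerSpectrum H n (fun ℓ => ε ℓ ω) x‖} ≤ 4 * Real.exp (-Λ) := by
  have hmem : ∀ ℓ ∈ Finset.Ioo (-(n : ℤ)) n, |ℓ| < n := fun ℓ hℓ => abs_lt.2 (Finset.mem_Ioo.1 hℓ)
  set z : ℤ → ℂ := fun ℓ => (hbar H n * H (|(ℓ : ℝ)| / n) : ℝ) * fourier ℓ x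
  have hz (ℓ : ℤ) : ‖z ℓ‖ ^ 2 = (hbar H n * H (|(ℓ : ℝ)| / n)) ^ 2 := by
    rw [norm_mul, norm_fourier_apply, mul_one, Complex.norm_real, Real.norm_eq_abs, sq_abs]
  have hsum (ω : Ω) : powerSpectrum H n (fun ℓ => ε ℓ ω) x
      = ∑ i ∈ (Finset.Ioo (-(n : ℤ)) n).subtype fun ℓ => |ℓ| < (n : ℤ), z i * ε i ω := by
    rw [powerSpectrum_eq_sum, Finset.sum_subtype_of_mem (fun ℓ => z ℓ * ε ℓ ω) hmem]
    exact Finset.sum_congr rfl fun ℓ _ => mul_right_comm _ _ _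
  simp only [hsum]
  refine measureReal_norm_sum_mul_ge_le hind (fun i _ => hsub i i.2) hr hΛ ?_
  rw [Finset.sum_subtype_of_mem (fun ℓ => ‖z ℓ‖ ^ 2) hmem, Finset.sum_congr rfl fun ℓ _ => hz ℓ]
  calc _ ≤ n * r ^ 2 * (n : ℝ)⁻¹ := by gcongr; exact hH.sum_hbar_mul_sq_le hn
    _ = r ^ 2 := by field_simp

theorem exists_forall_norm_powerSpectrum_le (hH : IsLowPassFilter H) (hn : 0 < n)
    (hind : iIndepFun (fun ℓ : {ℓ : ℤ // |ℓ| < n} => ε ℓ) P)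
    (hsub : ∀ ℓ : ℤ, |ℓ| < n → IsComplexSubGaussian (ε ℓ) V P) (hr : 0 < r) (hΛ : 0 ≤ Λ)
    (hV : 4 * V ^ 2 * Λ ≤ n * r ^ 2) :
    ∃ E : Set Ω, MeasurableSet E ∧ 1 - 104 * n ^ 2 * Real.exp (-Λ) ≤ P.real E ∧
      ∀ ω ∈ E, ∀ x, ‖powerSpectrum H n (fun ℓ => ε ℓ ω) x‖ ≤ 4 * r := by
  have := hind.isProbabilityMeasure
  have : Fact (0 < 2 * Real.pi) := ⟨Real.two_pi_pos⟩
  obtain ⟨s, hcard, hs⟩ := exists_norming_finset (2 * Real.pi) hn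
  set bad : Set Ω := ⋃ y ∈ s, {ω | 2 * r ≤ ‖powerSpectrum H n (fun ℓ => ε ℓ ω) y‖}
  have hbad : P.real bad ≤ 104 * n ^ 2 * Real.exp (-Λ) := calc
    P.real bad ≤ ∑ y ∈ s, P.real _ := measureReal_biUnion_finset_le _ _
    _ ≤ ∑ y ∈ s, 4 * Real.exp (-Λ) := Finset.sum_le_sum fun y _ =>
        hH.measureReal_norm_powerSpectrum_ge_le hn hind hsub hr hΛ hV y
    _ = s.card * (4 * Real.exp (-Λ)) := by rw [Finset.sum_const, nsmul_eq_mul]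
    _ ≤ (26 * n ^ 2) * (4 * Real.exp (-Λ)) := by gcongr; exact_mod_cast hcard
    _ = 104 * n ^ 2 * Real.exp (-Λ) := by ring
  refine ⟨(toMeasurable P bad)ᶜ, (measurableSet_toMeasurable P bad).compl, ?_, fun ω hω x => ?_⟩
  · rw [probReal_compl_eq_one_sub (measurableSet_toMeasurable P bad), Measure.real,
      measure_toMeasurable]
    exact sub_le_sub_left hbad 1
  · have hgrid : ∀ y ∈ s, ‖powerSpectrum H n (fun ℓ => ε ℓ ω) y‖ ≤ 2 * r := fun y hy =>
      (not_le.1 fun h => hω (subset_toMeasurable P bad (Set.mem_biUnion hy h))).le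
    simp only [powerSpectrum_eq_sum] at hgrid ⊢
    exact (hs _ _ hgrid x).trans_eq (by ring)

theorem exists_lt_measureReal_forall_norm_powerSpectrum_le (hH : IsLowPassFilter H) (hn : 0 < n)
    (hind : iIndepFun (fun ℓ : {ℓ : ℤ // |ℓ| < n} => ε ℓ) P)
    (hsub : ∀ ℓ : ℤ, |ℓ| < n → IsComplexSubGaussian (ε ℓ) V P) {δ : ℝ} (hδ : 0 < δ) (hδ1 : δ < 1)
    {t : ℝ} (ht : 0 < t) (hV : 16 * V * √(Real.log (4 * n / δ) / n) ≤ t) :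
    ∃ E : Set Ω, MeasurableSet E ∧ 1 - δ < P.real E ∧
      ∀ ω ∈ E, ∀ x, ‖powerSpectrum H n (fun ℓ => ε ℓ ω) x‖ ≤ t := by
  have hn1 : (1 : ℝ) ≤ n := by exact_mod_cast hn
  have hlog : 0 ≤ Real.log (4 * n / δ) :=
    Real.log_nonneg ((one_le_div hδ).2 (by linarith))
  have hsq : 256 * V ^ 2 * (Real.log (4 * n / δ) / n) ≤ t ^ 2 := calc
    _ = (16 * V * √(Real.log (4 * n / δ) / n)) ^ 2 := by
        rw [mul_pow, Real.sq_sqrt (by positivity)]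
        ring
    _ ≤ t ^ 2 := by gcongr
  have hV' : 4 * V ^ 2 * (4 * Real.log (4 * n / δ)) ≤ n * (t / 4) ^ 2 := by
    rw [mul_div_assoc', div_le_iff₀ (by positivity)] at hsq
    linarith
  obtain ⟨E, hE, hPE, hbound⟩ := hH.exists_forall_norm_powerSpectrum_le hn hind hsub
    (r := t / 4) (by positivity) (by positivity) hV'
  exact ⟨E, hE, by linarith [mul_sq_mul_exp_neg_log_lt hn hδ hδ1],
    fun ω hω x => (hbound ω hω x).trans_eq (by ring)⟩

end IsLowPassFilter

end Noise

section Clusters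

theorem half_edist_le_edist_of_mem_closedBall {X : Type*} [PseudoMetricSpace X] {a b x y : X}
    {r : ℝ} (hab : 4 * r ≤ dist a b) (hx : x ∈ Metric.closedBall a r)
    (hy : y ∈ Metric.closedBall b r) : edist a b / 2 ≤ edist x y := by
  have hhalf : dist a b / 2 ≤ dist x y := by
    linarith [dist_triangle4 a x y b, Metric.mem_closedBall'.1 hx, Metric.mem_closedBall.1 hy]
  rw [edist_dist, edist_dist, ← ENNReal.ofReal_ofNat 2, ← ENNReal.ofReal_div_of_pos two_pos]
  exact ENNReal.ofReal_le_ofReal hhalf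

theorem exists_clusters_of_subset_iUnion_closedBall {X ι : Type*} [PseudoMetricSpace X]
    [ProperSpace X] {f : X → ℝ} (hf : Continuous f) {c r ρ : ℝ} (hρ : 0 < ρ) (hρr : ρ ≤ r)
    {a : ι → X} (hsep : ∀ k l, k ≠ l → 4 * r ≤ dist (a k) (a l))
    (hcover : {x | c ≤ f x} ⊆ ⋃ k, Metric.closedBall (a k) r)
    (hball : ∀ k, Metric.closedBall (a k) ρ ⊆ {x | c ≤ f x}) :
    ∃ G : ι → Set X, {x | c ≤ f x} = ⋃ k, G k ∧ Pairwise (fun k l => Disjoint (G k) (G l)) ∧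
      (∀ k, Metric.diam (G k) ≤ 2 * r) ∧
      (∀ k l, k ≠ l → ∀ x ∈ G k, ∀ y ∈ G l, edist (a k) (a l) / 2 ≤ edist x y) ∧
      (∀ k, Metric.closedBall (a k) ρ ⊆ G k) ∧ (∀ k, ∃ x ∈ G k, IsMaxOn f (G k) x) ∧
      ∀ k, G k ⊆ Metric.closedBall (a k) r := by
  have hball' (k : ι) : Metric.closedBall (a k) ρ ⊆ {x | c ≤ f x} ∩ Metric.closedBall (a k) r :=
    Set.subset_inter (hball k) (Metric.closedBall_subset_closedBall hρr)
  refine ⟨fun k => {x | c ≤ f x} ∩ Metric.closedBall (a k) r, ?_, fun k l hkl => ?_, fun k => ?_,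
    fun k l hkl x hx y hy => half_edist_le_edist_of_mem_closedBall (hsep k l hkl) hx.2 hy.2,
    hball', fun k => ?_, fun k => Set.inter_subset_right⟩
  · rw [← Set.inter_iUnion, Set.inter_eq_left.2 hcover]
  · exact (Metric.closedBall_disjoint_closedBall (by linarith [hsep k l hkl])).mono
      Set.inter_subset_right Set.inter_subset_right
  · exact (Metric.diam_mono Set.inter_subset_right Metric.isBounded_closedBall).trans
      (Metric.diam_closedBall (hρ.le.trans hρr))
  · exact ((isCompact_closedBall _ _).inter_left (isClosed_le continuous_const hf)).exists_isMaxOn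
      ⟨a k, hball' k (Metric.mem_closedBall_self hρ.le)⟩ hf.continuousOn

theorem continuous_powerSpectrum (H : ℝ → ℝ) (n : ℕ) (d : ℤ → ℂ) :
    Continuous (powerSpectrum H n d) := by
  unfold powerSpectrum
  fun_prop

variable {K : ℕ} {A : Fin K → ℂ}

theorem powerSpectrum_fourierData_add (H : ℝ → ℝ) (n : ℕ) (A : Fin K → ℂ) (lam : Fin K → Torus)
    (d : ℤ → ℂ) (x : Torus) :
    powerSpectrum H n (fun ℓ => fourierData A lam ℓ + d ℓ) x
      = ∑ k, A k * lowPassKernel H n (x - lam k) + powerSpectrum H n d x := by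
  have hterm (ℓ : ℤ) (w : ℂ) : w * fourierData A lam ℓ * fourier ℓ x
      = ∑ k, A k * (w * fourier ℓ (x - lam k)) := by
    rw [fourierData, mul_assoc, Finset.sum_mul, Finset.mul_sum]
    refine Finset.sum_congr rfl fun k _ => ?_
    rw [← fourier_neg_mul_fourier]
    ring
  simp only [lowPassKernel, powerSpectrum_eq_sum, mul_add, add_mul, Finset.sum_add_distrib, hterm,
    Pi.one_apply, mul_one, Finset.mul_sum]
  rw [Finset.sum_comm]

theorem minAmplitude_le (A : Fin K → ℂ) (k : Fin K) : minAmplitude A ≤ ‖A k‖ :=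
  ciInf_le (Set.finite_range _).bddBelow k

theorem minAmplitude_pos (hK : 0 < K) (hA : ∀ k, A k ≠ 0) : 0 < minAmplitude A := by
  have : Nonempty (Fin K) := ⟨⟨0, hK⟩⟩
  obtain ⟨k, hk⟩ := exists_eq_ciInf_of_finite (f := fun k => ‖A k‖)
  rw [minAmplitude, ← hk]
  exact norm_pos_iff.2 (hA k)

theorem one_le_clusterConst (H : ℝ → ℝ) (S : ℕ) (A : Fin K → ℂ) : 1 ≤ clusterConst H S A :=
  le_max_left _ _

theorem one_div_four_mul_le (H : ℝ → ℝ) (S : ℕ) (A : Fin K → ℂ) (n : ℕ) :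
    1 / (4 * n) ≤ clusterConst H S A / n := by
  rw [← div_div]
  gcongr
  linarith [one_le_clusterConst H S A]

theorem minSeparation_le (lam : Fin K → Torus) {k l : Fin K} (h : k ≠ l) :
    minSeparation lam ≤ edist (lam k) (lam l) :=
  iInf_le_of_le k (iInf_le_of_le l (iInf_le _ h))

theorem div_le_dist_of_div_minSeparation_le {lam : Fin K → Torus} {c : ℝ} (hc : 0 < c) {n : ℕ}
    (hn : 0 < n) (h : ENNReal.ofReal c / minSeparation lam ≤ n) {k l : Fin K} (hkl : k ≠ l) :
    c / n ≤ dist (lam k) (lam l) := by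
  have hdiv : ENNReal.ofReal c / edist (lam k) (lam l) ≤ n :=
    (ENNReal.div_le_div_left (minSeparation_le lam hkl) _).trans h
  have hne : edist (lam k) (lam l) ≠ 0 := fun h0 => by
    rw [h0, ENNReal.div_zero (ENNReal.ofReal_pos.2 hc).ne'] at hdiv
    exact ENNReal.natCast_ne_top n (top_le_iff.1 hdiv)
  rw [ENNReal.div_le_iff hne (edist_ne_top _ _), edist_dist, ← ENNReal.ofReal_natCast,
    ← ENNReal.ofReal_mul n.cast_nonneg, ENNReal.ofReal_le_ofReal_iff (by positivity)] at hdiv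
  rwa [div_le_iff₀' (by positivity)]

namespace IsLowPassFilter

variable {H : ℝ → ℝ} {S n : ℕ} {lam : Fin K → Torus} {d : ℤ → ℂ}

theorem totalAmplitude_mul_locConst_div_pow_le (hH : IsLowPassFilter H) (hS : S ≠ 0) (hK : 0 < K)
    (hA : ∀ k, A k ≠ 0) :
    totalAmplitude A * (locConst H S / clusterConst H S A ^ S) ≤ minAmplitude A / 16 := by
  have hm := minAmplitude_pos hK hA
  have hL := hH.locConst_nonneg S
  have hM : 0 ≤ totalAmplitude A := Finset.sum_nonneg fun _ _ => norm_nonneg _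
  have hC := one_le_clusterConst H S A
  have hpow : 16 * totalAmplitude A * locConst H S / minAmplitude A ≤ clusterConst H S A ^ S :=
    calc _ = ((16 * totalAmplitude A * locConst H S / minAmplitude A) ^ (1 / (S : ℝ))) ^ S := by
          rw [one_div, Real.rpow_inv_natCast_pow (by positivity) hS]
      _ ≤ clusterConst H S A ^ S := by gcongr; exact le_max_right _ _
  rw [div_le_iff₀ hm] at hpow
  rw [mul_div_assoc', div_le_iff₀ (by positivity)]
  linarith

theorem norm_sum_mul_lowPassKernel_le (hH : IsLowPassFilter H) (hS : 2 ≤ S) (hK : 0 < K)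
    (hA : ∀ k, A k ≠ 0) (hn : 0 < n) (s : Finset (Fin K)) {x : Torus}
    (hx : ∀ k ∈ s, clusterConst H S A / n ≤ dist x (lam k)) :
    ‖∑ k ∈ s, A k * lowPassKernel H n (x - lam k)‖ ≤ minAmplitude A / 16 := by
  have hC := one_le_clusterConst H S A
  have hL := hH.locConst_nonneg S
  have hker : ∀ k ∈ s, ‖lowPassKernel H n (x - lam k)‖ ≤ locConst H S / clusterConst H S A ^ S :=
    fun k hk => by
      have hfar := hx k hk
      rw [dist_eq_norm] at hfar
      have hne : x - lam k ≠ 0 := norm_pos_iff.1 (hfar.trans_lt' (by positivity))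
      rw [div_le_iff₀' (by positivity)] at hfar
      exact (hH.norm_lowPassKernel_le hn hS hne).trans (by gcongr)
  calc ‖∑ k ∈ s, A k * lowPassKernel H n (x - lam k)‖
      ≤ ∑ k ∈ s, ‖A k‖ * (locConst H S / clusterConst H S A ^ S) :=
        norm_sum_le_of_le _ fun k hk => by
          rw [norm_mul]
          gcongr
          exact hker k hk
    _ ≤ ∑ k, ‖A k‖ * (locConst H S / clusterConst H S A ^ S) :=
        Finset.sum_le_sum_of_subset_of_nonneg (Finset.subset_univ _) fun _ _ _ => by positivity
    _ = totalAmplitude A * (locConst H S / clusterConst H S A ^ S) := (Finset.sum_mul ..).symm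
    _ ≤ minAmplitude A / 16 := hH.totalAmplitude_mul_locConst_div_pow_le (by omega) hK hA

theorem levelSet_subset_iUnion_closedBall (hH : IsLowPassFilter H) (hS : 2 ≤ S) (hK : 0 < K)
    (hA : ∀ k, A k ≠ 0) (hn : 0 < n) (hd : ∀ x, ‖powerSpectrum H n d x‖ ≤ minAmplitude A / 16) :
    levelSet (powerSpectrum H n fun ℓ => fourierData A lam ℓ + d ℓ) (minAmplitude A)
      ⊆ ⋃ k, Metric.closedBall (lam k) (clusterConst H S A / n) := by
  intro x hx
  by_contra hfar
  simp only [Set.mem_iUnion, Metric.mem_closedBall, not_exists, not_le] at hfar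
  rw [levelSet, Set.mem_ofPred_eq, powerSpectrum_fourierData_add] at hx
  have hsum := hH.norm_sum_mul_lowPassKernel_le hS hK hA hn Finset.univ fun k _ => (hfar k).le
  have htri := hx.trans (norm_add_le_of_le hsum (hd x))
  linarith [minAmplitude_pos hK hA]

theorem closedBall_subset_levelSet (hH : IsLowPassFilter H) (hS : 2 ≤ S) (hK : 0 < K)
    (hA : ∀ k, A k ≠ 0) (hn : 0 < n) (hd : ∀ x, ‖powerSpectrum H n d x‖ ≤ minAmplitude A / 16)
    (hsep : ∀ k l, k ≠ l → 4 * (clusterConst H S A / n) ≤ dist (lam k) (lam l)) (k : Fin K) :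
    Metric.closedBall (lam k) (1 / (4 * n))
      ⊆ levelSet (powerSpectrum H n fun ℓ => fourierData A lam ℓ + d ℓ) (minAmplitude A) := by
  intro x hx
  have hm := minAmplitude_pos hK hA
  have hnear : ‖x - lam k‖ ≤ 1 / (4 * n) := by rwa [← dist_eq_norm, ← Metric.mem_closedBall]
  have hmain : minAmplitude A * (31 / 32) ≤ ‖A k * lowPassKernel H n (x - lam k)‖ := by
    rw [norm_mul]
    gcongr
    · exact minAmplitude_le A k
    · exact hH.le_norm_lowPassKernel hn hnear
  have hrest : ‖∑ l ∈ Finset.univ.erase k, A l * lowPassKernel H n (x - lam l)‖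
      ≤ minAmplitude A / 16 :=
    hH.norm_sum_mul_lowPassKernel_le hS hK hA hn _ fun l hl => by
      have hkl := hsep k l (Finset.ne_of_mem_erase hl).symm
      have hball := Metric.closedBall_subset_closedBall (one_div_four_mul_le H S A n) hx
      linarith [dist_triangle_left (lam k) (lam l) x, Metric.mem_closedBall.1 hball,
        dist_nonneg.trans (Metric.mem_closedBall.1 hball)]
  rw [levelSet, Set.mem_ofPred_eq, powerSpectrum_fourierData_add,
    ← Finset.add_sum_erase _ _ (Finset.mem_univ k), add_assoc]
  have hperturb := norm_le_add_norm_add (A k * lowPassKernel H n (x - lam k))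
    (∑ l ∈ Finset.univ.erase k, A l * lowPassKernel H n (x - lam l) + powerSpectrum H n d x)
  linarith [norm_add_le_of_le hrest (hd x)]

end IsLowPassFilter

end Clusters

theorem theorem2p3p1_general {H : ℝ → ℝ} (hH : IsLowPassFilter H) {S : ℕ} (hS : 2 ≤ S) {K : ℕ}
    (hK : 0 < K) {A : Fin K → ℂ} {lam : Fin K → Torus} (hA : ∀ k, A k ≠ 0) {V : ℝ≥0} {δ : ℝ}
    (hδ : 0 < δ) (hδ1 : δ < 1) {n : ℕ} (hn : 0 < n)
    (hsep : ENNReal.ofReal (4 * clusterConst H S A) / minSeparation lam ≤ n)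
    (hV : 16 * V * √(Real.log (4 * n / δ) / n) ≤ minAmplitude A / 16)
    {Ω : Type*} [MeasurableSpace Ω] {P : Measure Ω} {ε : ℤ → Ω → ℂ}
    (hind : iIndepFun (fun ℓ : {ℓ : ℤ // |ℓ| < n} => ε ℓ) P)
    (hsub : ∀ ℓ : ℤ, |ℓ| < n → IsComplexSubGaussian (ε ℓ) V P) :
    ∃ E : Set Ω, MeasurableSet E ∧ 1 - δ < P.real E ∧ ∀ ω ∈ E,
      ∀ σ : Torus → ℂ, σ = powerSpectrum H n (fun ℓ => fourierData A lam ℓ + ε ℓ ω) →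
      ∃ G : Fin K → Set Torus,
        levelSet σ (minAmplitude A) = ⋃ k, G k ∧
        Pairwise (fun k l => Disjoint (G k) (G l)) ∧
        (∀ k, Metric.diam (G k) ≤ 2 * clusterConst H S A / n) ∧
        (∀ k l, k ≠ l → ∀ x ∈ G k, ∀ y ∈ G l, minSeparation lam / 2 ≤ edist x y) ∧
        (∀ k, Metric.closedBall (lam k) (1 / (4 * n)) ⊆ G k) ∧
        (∀ k, ∃ x ∈ G k, IsMaxOn (fun y => ‖σ y‖) (G k) x) ∧
        (∀ k, ∀ x ∈ G k, IsMaxOn (fun y => ‖σ y‖) (G k) x →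
          dist x (lam k) ≤ 2 * clusterConst H S A / n) := by
  have hm := minAmplitude_pos hK hA
  have hC := one_le_clusterConst H S A
  obtain ⟨E, hE, hPE, hnoise⟩ := hH.exists_lt_measureReal_forall_norm_powerSpectrum_le hn hind hsub
    hδ hδ1 (by positivity) hV
  have hsep' (k l : Fin K) (hkl : k ≠ l) :
      4 * (clusterConst H S A / n) ≤ dist (lam k) (lam l) := by
    rw [mul_div_assoc']
    exact div_le_dist_of_div_minSeparation_le (by positivity) hn hsep hkl
  have : Fact (0 < 2 * Real.pi) := ⟨Real.two_pi_pos⟩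
  refine ⟨E, hE, hPE, fun ω hω σ hσ => ?_⟩
  subst hσ
  obtain ⟨G, hunion, hdisjoint, hdiam, hdist, hball, hmax, hG⟩ :=
    exists_clusters_of_subset_iUnion_closedBall (continuous_powerSpectrum H n _).norm
      (by positivity : (0 : ℝ) < 1 / (4 * n)) (one_div_four_mul_le H S A n) hsep'
      (hH.levelSet_subset_iUnion_closedBall hS hK hA hn (hnoise ω hω))
      (hH.closedBall_subset_levelSet hS hK hA hn (hnoise ω hω) hsep')
  simp only [mul_div_assoc]
  refine ⟨G, hunion, hdisjoint, hdiam, fun k l hkl x hx y hy => ?_, hball, hmax,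
    fun k x hx _ => ?_⟩
  · exact (ENNReal.div_le_div_right (minSeparation_le lam hkl) 2).trans (hdist k l hkl x hx y hy)
  · exact (Metric.mem_closedBall.1 (hG k hx)).trans
      (le_mul_of_one_le_left (by positivity) (by norm_num))

theorem theorem2p3p1 (H : ℝ → ℝ) (hH : IsLowPassFilter H) :
    -- the constants depend on the filter only
    ∃ C₁ C₂ C₃ : ℝ, 1 ≤ C₁ ∧ 0 < C₂ ∧ 0 < C₃ ∧
      ∀ (S : ℕ), 2 ≤ S →
      ∀ (K : ℕ), 1 ≤ K →
      ∀ (A : Fin K → ℂ) (lam : Fin K → Torus), (∀ k, A k ≠ 0) →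
      ∀ (V : ℝ≥0) (δ : ℝ), 0 < δ → δ < 1 →
      ∀ (n : ℕ),
        -- `n` is sufficiently large
        C₁ ≤ n →
        ENNReal.ofReal (4 * clusterConst H S A) / minSeparation lam ≤ n →
        C₂ * V * √(Real.log (C₃ * n / δ) / n) ≤ minAmplitude A / 16 →
      ∀ {Ω : Type*} [MeasurableSpace Ω] (P : Measure Ω) [IsProbabilityMeasure P]
        (ε : ℤ → Ω → ℂ),
        -- the noise `ε_ℓ`, `|ℓ| < n`, is i.i.d. and sub-Gaussian with parameter `V`
        iIndepFun (fun ℓ : {ℓ : ℤ // |ℓ| < n} => ε ℓ) P →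
        (∀ ℓ ℓ' : ℤ, |ℓ| < n → |ℓ'| < n → IdentDistrib (ε ℓ) (ε ℓ') P P) →
        (∀ ℓ : ℤ, |ℓ| < n → IsComplexSubGaussian (ε ℓ) V P) →
        ∃ E : Set Ω, MeasurableSet E ∧ 1 - δ < P.real E ∧ ∀ ω ∈ E,
          ∀ σ : Torus → ℂ, σ = powerSpectrum H n (fun ℓ => fourierData A lam ℓ + ε ℓ ω) →
          ∃ G : Fin K → Set Torus,
            -- disjoint union
            levelSet σ (minAmplitude A) = ⋃ k, G k ∧
            Pairwise (fun k l => Disjoint (G k) (G l)) ∧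
            -- diameter
            (∀ k, Metric.diam (G k) ≤ 2 * clusterConst H S A / n) ∧
            -- separation
            (∀ k l, k ≠ l → ∀ x ∈ G k, ∀ y ∈ G l, minSeparation lam / 2 ≤ edist x y) ∧
            -- interval inclusion
            (∀ k, Metric.closedBall (lam k) (1 / (4 * n)) ⊆ G k) ∧
            -- the maximum of `|σ_n|` on each cluster is attained, and every maximizer is close
            -- to the corresponding point
            (∀ k, ∃ x ∈ G k, IsMaxOn (fun y => ‖σ y‖) (G k) x) ∧
            (∀ k, ∀ x ∈ G k, IsMaxOn (fun y => ‖σ y‖) (G k) x →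
              dist x (lam k) ≤ 2 * clusterConst H S A / n) := by
  exact ⟨1, 16, 4, le_rfl, by norm_num, by norm_num,
    fun S hS K hK A lam hA V δ hδ hδ1 n hn hsep hV Ω _ P _ ε hind _ hsub =>
      theorem2p3p1_general hH hS hK hA hδ hδ1 (by exact_mod_cast hn) hsep hV hind hsub⟩
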